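/- Let $(G_i)_{i\in I}$ be a finite or countably infinite family of countable discrete Abelian groups with a common countable subgroup $H$ (given by injective homomorphisms $\varphi_i : H\to G_i$), and let $G=\star_H G_i$ be their free product amalgamated over $H$. Let $\hat H$ and $\hat G_i$ be the compact dual groups, let $L^\infty(\hat H)$ be the algebra of classes of essentially bounded measurable functions with respect to Haar measure on $\hat H$, acting on $L^2(\hat H)$ by multiplication, and let $\otimes$ be the spatial (minimal) $C^*$-tensor product. For a discrete group $\Gamma$, let $\lambda_\gamma$ $(\gamma\in\Gamma)$ be the left translation operators on $\ell^2(\Gamma)$ and $C^*_r(\Gamma)\subseteq B(\ell^2(\Gamma))$ the unital $C^*$-algebra that they generate. Then there is an injective unital $*$-homomorphism $$\psi: C^*_r(G)\to C^*_r\bigl(\star_i (G_i/H)\bigr)\otimes L^\infty(\hat H).$$ Moreover, $\psi$ can be chosen so that there are Borel maps $e_i:\hat H\to\hat G_i$ $(i\in I)$, with $e_i(\omega)$ a character of $G_i$ extending $\omega$ for every $\omega\in\hat H$, such that for all $i\in I$ and $g\in G_i$ $$\psi(\lambda_g)=\lambda_{gH}\otimes \bigl[\omega\mapsto e_i(\omega)(g)\bigr],$$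 where $gH\in G_i/H$ is viewed as an element of the free product $\star_i (G_i/H)$. -/

import Mathlib

open scoped ENNReal TensorProduct
open MeasureTheory

/-! ### The reduced group C*-algebra of a discrete group -/

/-- The Hilbert space `ℓ²(Γ)`. -/
abbrev EllTwo (Γ : Type*) : Type _ := lp (fun _ : Γ => ℂ) 2

theorem memℓp_leftTranslate {Γ : Type*} [Group Γ] (g : Γ) (f : EllTwo Γ) :
    Memℓp (fun x : Γ => f (g⁻¹ * x)) 2 := by
  have h2 : 0 < (2 : ℝ≥0∞).toReal := by norm_num
  exact memℓp_gen (((Equiv.mulLeft g⁻¹).summable_iff).2 ((lp.memℓp f).summable h2))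

/-- Left translation `(leftTranslate g f) x = f (g⁻¹ x)` on `ℓ²(Γ)`. -/
noncomputable def leftTranslate {Γ : Type*} [Group Γ] (g : Γ) :
    EllTwo Γ →L[ℂ] EllTwo Γ :=
  LinearMap.mkContinuous
    { toFun := fun f => ⟨fun x => f (g⁻¹ * x), memℓp_leftTranslate g f⟩
      map_add' := fun _ _ => rfl
      map_smul' := fun _ _ => rfl } 1 (by
    intro f
    have h2 : 0 < (2 : ℝ≥0∞).toReal := by norm_num
    rw [one_mul, lp.norm_eq_tsum_rpow h2, lp.norm_eq_tsum_rpow h2]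
    refine le_of_eq (congrArg (fun t : ℝ => t ^ (1 / (2 : ℝ≥0∞).toReal)) ?_)
    exact (Equiv.mulLeft g⁻¹).tsum_eq (fun x => ‖f x‖ ^ (2 : ℝ≥0∞).toReal))

@[simp]
theorem leftTranslate_apply {Γ : Type*} [Group Γ] (g : Γ) (f : EllTwo Γ) (x : Γ) :
    leftTranslate g f x = f (g⁻¹ * x) := rfl

/-- The left regular representation of `Γ` on `ℓ²(Γ)`. -/
noncomputable def leftRegular (Γ : Type*) [Group Γ] :
    Γ →* (EllTwo Γ →L[ℂ] EllTwo Γ) where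
  toFun := leftTranslate
  map_one' := by
    refine ContinuousLinearMap.ext fun f => lp.ext (funext fun x => ?_)
    simp
  map_mul' g h := by
    refine ContinuousLinearMap.ext fun f => lp.ext (funext fun x => ?_)
    simp [mul_assoc]

/-- The reduced group C*-algebra: the unital C*-subalgebra of `B(ℓ²(Γ))` generated by the
left regular representation. -/
noncomputable def reducedCStar (Γ : Type*) [Group Γ] :
    StarSubalgebra ℂ (EllTwo Γ →L[ℂ] EllTwo Γ) :=
  (StarAlgebra.adjoin ℂ (Set.range (leftRegular Γ))).topologicalClosure

theorem leftRegular_mem (Γ : Type*) [Group Γ] (g : Γ) : leftRegular Γ g ∈ reducedCStar Γ :=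
  StarSubalgebra.le_topologicalClosure _
    (StarAlgebra.subset_adjoin ℂ _ (Set.mem_range_self g))

/-- The canonical unitary `λ_g` as an element of the reduced group C*-algebra. -/
noncomputable def groupUnitary {Γ : Type*} [Group Γ] (g : Γ) : reducedCStar Γ :=
  ⟨leftRegular Γ g, leftRegular_mem Γ g⟩

/-! ### The algebra `L^∞`, acting on `L²` by multiplication -/

/-- The multiplication operator on `L²(μ)` given by the class `f ∈ L^∞(μ)`. -/
noncomputable def mulOp {X : Type*} [MeasurableSpace X] (μ : Measure X) (f : Lp ℂ ∞ μ) :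
    Lp ℂ 2 μ →L[ℂ] Lp ℂ 2 μ :=
  LinearMap.mkContinuous
    { toFun := fun u => (f • u : Lp ℂ 2 μ)
      map_add' := fun u v => Lp.add_smul f u v
      map_smul' := fun c u => (Lp.smul_comm c f u).symm } ‖f‖
    (fun u => Lp.norm_smul_le f u)

theorem mulOp_apply_ae {X : Type*} [MeasurableSpace X] (μ : Measure X) (f : Lp ℂ ∞ μ)
    (u : Lp ℂ 2 μ) : (mulOp μ f u : X → ℂ) =ᵐ[μ] fun x => f x * u x :=
  Lp.coeFn_lpSMul f u

/-- If `μ` is finite, then `f ↦ mulOp μ f` is injective, so that `L^∞(μ)` may be identified with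
the algebra of multiplication operators. -/
theorem mulOp_injective {X : Type*} [MeasurableSpace X] (μ : Measure X) [IsFiniteMeasure μ] :
    Function.Injective (mulOp μ) := by
  intro f g h
  have h1 : MemLp (fun _ : X => (1 : ℂ)) 2 μ := memLp_const 1
  have e1 := mulOp_apply_ae μ f (h1.toLp _)
  have e2 := mulOp_apply_ae μ g (h1.toLp _)
  rw [h] at e1
  refine Lp.ext ?_
  filter_upwards [e1, e2, h1.coeFn_toLp] with x a b c
  rw [a, c] at b
  simpa using b

theorem mulOp_eq_of_ae {X : Type*} [MeasurableSpace X] (μ : Measure X) (f : Lp ℂ ∞ μ)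
    (T : Lp ℂ 2 μ →L[ℂ] Lp ℂ 2 μ)
    (h : ∀ u : Lp ℂ 2 μ, (T u : X → ℂ) =ᵐ[μ] fun x => f x * u x) : mulOp μ f = T :=
  ContinuousLinearMap.ext fun u => Lp.ext ((mulOp_apply_ae μ f u).trans (h u).symm)

theorem mulOp_star {X : Type*} [MeasurableSpace X] (μ : Measure X) (f : Lp ℂ ∞ μ) :
    mulOp μ (star f) = star (mulOp μ f) := by
  rw [ContinuousLinearMap.star_eq_adjoint, ContinuousLinearMap.eq_adjoint_iff]
  intro u v
  rw [L2.inner_def, L2.inner_def]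
  refine integral_congr_ae ?_
  filter_upwards [mulOp_apply_ae μ (star f) u, mulOp_apply_ae μ f v, Lp.coeFn_star f]
    with x a b c
  rw [a, b, c]
  simp [RCLike.inner_apply]
  ring

/-- `L^∞(μ)`, the algebra of classes of essentially bounded measurable functions modulo equality
almost everywhere, realized as the algebra of multiplication operators on `L²(μ)`. -/
noncomputable def LInfty {X : Type*} [MeasurableSpace X] (μ : Measure X) :
    StarSubalgebra ℂ (Lp ℂ 2 μ →L[ℂ] Lp ℂ 2 μ) where
  carrier := Set.range (mulOp μ)
  mul_mem' := by
    rintro _ _ ⟨f, rfl⟩ ⟨g, rfl⟩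
    refine ⟨(f • g : Lp ℂ ∞ μ), mulOp_eq_of_ae μ _ _ fun u => ?_⟩
    filter_upwards [mulOp_apply_ae μ f (mulOp μ g u), mulOp_apply_ae μ g u,
      Lp.coeFn_lpSMul (r := ∞) f g] with x a b c
    rw [mul_apply_eq_comp, a, b, c]
    simp [mul_assoc]
  add_mem' := by
    rintro _ _ ⟨f, rfl⟩ ⟨g, rfl⟩
    exact ⟨f + g, ContinuousLinearMap.ext fun u => Lp.smul_add f g u⟩
  algebraMap_mem' c := by
    have h1 : MemLp (fun _ : X => c) ∞ μ := memLp_top_const c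
    refine ⟨h1.toLp _, mulOp_eq_of_ae μ _ _ fun u => ?_⟩
    rw [Algebra.algebraMap_eq_smul_one]
    filter_upwards [Lp.coeFn_smul c u, h1.coeFn_toLp] with x a b
    simpa [b] using a
  star_mem' := by
    rintro _ ⟨f, rfl⟩
    exact ⟨star f, mulOp_star μ f⟩

/-! ### The spatial tensor product of concrete C*-algebras -/

/-- The Hilbert space tensor product. -/
def HilbertTensor (E F : Type*) [NormedAddCommGroup E] [InnerProductSpace ℂ E]
    [NormedAddCommGroup F] [InnerProductSpace ℂ F] : Type _ :=
  UniformSpace.Completion (E ⊗[ℂ] F)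

noncomputable instance HilbertTensor.instNormedAddCommGroup (E F : Type*)
    [NormedAddCommGroup E] [InnerProductSpace ℂ E]
    [NormedAddCommGroup F] [InnerProductSpace ℂ F] :
    NormedAddCommGroup (HilbertTensor E F) :=
  inferInstanceAs (NormedAddCommGroup (UniformSpace.Completion (E ⊗[ℂ] F)))

noncomputable instance HilbertTensor.instInnerProductSpace (E F : Type*)
    [NormedAddCommGroup E] [InnerProductSpace ℂ E]
    [NormedAddCommGroup F] [InnerProductSpace ℂ F] :
    InnerProductSpace ℂ (HilbertTensor E F) :=
  inferInstanceAs (InnerProductSpace ℂ (UniformSpace.Completion (E ⊗[ℂ] F)))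

instance HilbertTensor.instCompleteSpace (E F : Type*)
    [NormedAddCommGroup E] [InnerProductSpace ℂ E]
    [NormedAddCommGroup F] [InnerProductSpace ℂ F] :
    CompleteSpace (HilbertTensor E F) :=
  inferInstanceAs (CompleteSpace (UniformSpace.Completion (E ⊗[ℂ] F)))

/-- The bounded operator `S ⊗ T` on the Hilbert space tensor product. -/
noncomputable def opTensor {E F : Type*} [NormedAddCommGroup E] [InnerProductSpace ℂ E]
    [NormedAddCommGroup F] [InnerProductSpace ℂ F] (S : E →L[ℂ] E) (T : F →L[ℂ] F) :
    HilbertTensor E F →L[ℂ] HilbertTensor E F :=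
  (TensorProduct.mapL S T).completion

/-- The spatial (minimal) tensor product of `A ⊆ B(E)` and `B ⊆ B(F)`: the C*-subalgebra of
`B(E ⊗ F)` generated by the operators `a ⊗ b` with `a ∈ A` and `b ∈ B`. -/
noncomputable def spatialTensor {E F : Type*} [NormedAddCommGroup E] [InnerProductSpace ℂ E]
    [CompleteSpace E] [NormedAddCommGroup F] [InnerProductSpace ℂ F] [CompleteSpace F]
    (A : StarSubalgebra ℂ (E →L[ℂ] E)) (B : StarSubalgebra ℂ (F →L[ℂ] F)) :
    StarSubalgebra ℂ (HilbertTensor E F →L[ℂ] HilbertTensor E F) :=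
  (StarAlgebra.adjoin ℂ
    {T | ∃ a ∈ A, ∃ b ∈ B, T = opTensor a b}).topologicalClosure

/-! ### Free products -/

/-- The free product of the quotients `G i / H`. -/
abbrev FreeProdQuotients {ι : Type*} {G : ι → Type*} {H : Type*} [∀ i, CommGroup (G i)]
    [CommGroup H] (φ : ∀ i, H →* G i) : Type _ :=
  Monoid.CoprodI fun i => G i ⧸ (φ i).range

/-! ### Measurable extension of characters -/

/-! Write `K` for the free product of the quotients. The image of `H` in the amalgam is central, and
it is the kernel of `quotientProj`, so the amalgam is a central extension of `K`. If the evaluation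
characters of `H` on its dual extend to a homomorphism `ε` from the amalgam to measurable
circle-valued functions, then `δ_g ↦ δ_{q g} ⊗ ε g`, suitably rescaled, is a unitary onto `ℓ²(K) ⊗
L²`, and it carries `λ_g` to `λ_{q g} ⊗ ε g`. Conjugation by it is the embedding.

The existence of `ε` is algebraic: measurable circle-valued functions form a divisible, hence
injective, group. So evaluation extends from `H` to each `G i`, and the extensions glue by the
universal property. The unitary rests on orthogonality of characters (`orthonormal_twistedVec`) and
Stone–Weierstrass (`span_twistedVec_closure_eq_top`). -/

/-- The group of circle-valued measurable functions. -/
def measurableCircleFun (X : Type*) [MeasurableSpace X] : Subgroup (X → Circle) where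
  carrier := {f | Measurable fun x => (f x : ℂ)}
  mul_mem' {f g} hf hg := by
    change Measurable fun x => ((f x * g x : Circle) : ℂ)
    simp only [Circle.coe_mul]
    exact Measurable.mul hf hg
  one_mem' := by simp
  inv_mem' {f} hf := by
    change Measurable fun x => (((f x)⁻¹ : Circle) : ℂ)
    simp only [Circle.coe_inv]
    exact Measurable.inv hf

/-- The principal argument is Borel, so dividing it by `n` gives a measurable root. -/
theorem measurableCircleFun_pow_surjective {X : Type*} [MeasurableSpace X] {n : ℕ} (hn : n ≠ 0) :
    Function.Surjective fun f : measurableCircleFun X => f ^ n := by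
  rintro ⟨f, hf⟩
  have hf' : Measurable fun x => (f x : ℂ) := hf
  refine ⟨⟨fun x => Circle.exp (Complex.arg (f x) / n), ?_⟩, ?_⟩
  · change Measurable fun x => ((Circle.exp (Complex.arg (f x) / n) : Circle) : ℂ)
    have h : Continuous fun t : ℝ => ((Circle.exp t : Circle) : ℂ) := by fun_prop
    exact h.measurable.comp ((Complex.measurable_arg.comp hf').div_const _)
  · refine Subtype.ext (funext fun x => ?_)
    have hn' : (n : ℝ) ≠ 0 := Nat.cast_ne_zero.2 hn
    change Circle.exp (Complex.arg (f x) / n) ^ n = f x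
    rw [← Circle.exp_natCast_mul, mul_div_cancel₀ _ hn', Circle.exp_arg]

/-- Divisible Abelian groups are injective. Using functions, not classes modulo null sets, makes the
extended families multiplicative at every point. -/
theorem baer_measurableCircleFun (X : Type*) [MeasurableSpace X] :
    Module.Baer ℤ (Additive (measurableCircleFun X)) := by
  let : DivisibleBy (Additive (measurableCircleFun X)) ℕ :=
    divisibleByOfSMulRightSurj _ _ fun {n} hn => measurableCircleFun_pow_surjective hn
  let : DivisibleBy (Additive (measurableCircleFun X)) ℤ :=
    AddGroup.divisibleByIntOfDivisibleByNat _
  exact Module.Baer.of_divisible _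

/-- A measurable family of characters extends measurably to a larger Abelian group. -/
theorem exists_measurableCircleFun_extension {X : Type*} [MeasurableSpace X] {H G : Type*}
    [CommGroup H] [CommGroup G] (φ : H →* G) (hφ : Function.Injective φ)
    (c : H →* measurableCircleFun X) : ∃ E : G →* measurableCircleFun X, ∀ h, E (φ h) = c h := by
  obtain ⟨E, hE⟩ := (baer_measurableCircleFun X).extension_property_addMonoidHom
    (MonoidHom.toAdditive φ) hφ (MonoidHom.toAdditive c)
  exact ⟨MonoidHom.toAdditive.symm E, fun h => DFunLike.congr_fun hE (Additive.ofMul h)⟩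

/-! ### The dual of a countable discrete Abelian group -/

/-- The homomorphism `ℚ / ℤ → Circle`. -/
noncomputable def ratAddCircleToCircle : AddCircle (1 : ℚ) →+ Additive Circle :=
  QuotientAddGroup.lift _
    (Circle.expHom.comp
      ((AddMonoidHom.mulLeft (2 * Real.pi)).comp (Rat.castHom ℝ).toAddMonoidHom)) (by
    rintro _ ⟨n, rfl⟩
    refine (Circle.exp_eq_one.2 ⟨n, ?_⟩ : Circle.exp (2 * Real.pi * ((n • (1 : ℚ) : ℚ) : ℝ)) = 1)
    push_cast [zsmul_one]
    ring)

theorem ratAddCircleToCircle_injective : Function.Injective ratAddCircleToCircle := by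
  refine (injective_iff_map_eq_zero _).2 fun x hx => ?_
  obtain ⟨q, rfl⟩ := QuotientAddGroup.mk_surjective x
  obtain ⟨n, hn⟩ := Circle.exp_eq_one.1 (show Circle.exp (2 * Real.pi * (q : ℝ)) = 1 from hx)
  have hq : (q : ℝ) = n := by
    rw [mul_comm] at hn
    exact mul_right_cancel₀ Real.two_pi_pos.ne' hn
  refine (QuotientAddGroup.eq_zero_iff q).2 ⟨n, ?_⟩
  have hq' : q = n := by exact_mod_cast hq
  simp [hq']

/-- Homomorphisms to `ℚ / ℤ` separate points, and `ℚ / ℤ` embeds in the circle. -/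
theorem exists_pontryaginDual_apply_ne_one {A : Type*} [CommGroup A] [TopologicalSpace A]
    [DiscreteTopology A] {a : A} (ha : a ≠ 1) : ∃ χ : PontryaginDual A, χ a ≠ 1 := by
  obtain ⟨c, hc⟩ := CharacterModule.exists_character_apply_ne_zero_of_ne_zero
    (A := Additive A) (a := Additive.ofMul a) (fun h => ha h)
  let f : A →* Circle := MonoidHom.toAdditive.symm (ratAddCircleToCircle.comp c)
  let χ : A →ₜ* Circle := ⟨f, continuous_of_discreteTopology⟩
  refine ⟨(χ : PontryaginDual A), fun h => hc ?_⟩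
  exact ratAddCircleToCircle_injective (h.trans (map_zero ratAddCircleToCircle).symm)

/-- On a discrete group the compact-open topology is that of pointwise convergence. -/
theorem isInducing_pontryaginDual_coe (A : Type*) [Monoid A] [TopologicalSpace A]
    [DiscreteTopology A] :
    Topology.IsInducing fun (χ : PontryaginDual A) (a : A) => (χ a : ℂ) :=
  (Topology.IsInducing.piMap fun _ : A => Topology.IsInducing.subtypeVal).comp
    (ContinuousMonoidHom.isClosedEmbedding_coe (A := A) (B := Circle)).isInducing

theorem continuous_pontryaginDual_eval {A : Type*} [Monoid A] [TopologicalSpace A]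
    [DiscreteTopology A] (a : A) : Continuous fun χ : PontryaginDual A => (χ a : ℂ) :=
  (continuous_apply a).comp (isInducing_pontryaginDual_coe A).continuous

instance secondCountableTopology_pontryaginDual (A : Type*) [Monoid A] [TopologicalSpace A]
    [DiscreteTopology A] [Countable A] : SecondCountableTopology (PontryaginDual A) :=
  (isInducing_pontryaginDual_coe A).secondCountableTopology

/-- For countable `A`, the Borel σ-algebra of `A → ℂ` is the product one, so measurability is tested
by evaluations. -/
theorem measurable_pontryaginDual {X A : Type*} [MeasurableSpace X] [Monoid A]
    [TopologicalSpace A] [DiscreteTopology A] [Countable A] [MeasurableSpace (PontryaginDual A)]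
    [BorelSpace (PontryaginDual A)] {e : X → PontryaginDual A}
    (he : ∀ a, Measurable fun x => (e x a : ℂ)) : Measurable e := by
  have h : ‹MeasurableSpace (PontryaginDual A)› =
      MeasurableSpace.comap (fun (χ : PontryaginDual A) (a : A) => (χ a : ℂ)) inferInstance := by
    rw [BorelSpace.measurable_eq (α := PontryaginDual A),
      (isInducing_pontryaginDual_coe A).eq_induced, borel_comap,
      ← BorelSpace.measurable_eq (α := A → ℂ)]
  subst h
  exact measurable_comap_iff.2 (measurable_pi_iff.2 he)

/-- The evaluation map at an element of a discrete group, as a function on the dual. -/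
noncomputable def evalCM {A : Type*} [Monoid A] [TopologicalSpace A] [DiscreteTopology A] (a : A) :
    C(PontryaginDual A, ℂ) :=
  ⟨fun χ => (χ a : ℂ), continuous_pontryaginDual_eval a⟩

/-- Stone–Weierstrass: evaluations separate points and are closed under products and conjugation, so
their span is already a star subalgebra. -/
theorem span_evalCM_closure_eq_top (A : Type*) [CommGroup A] [TopologicalSpace A]
    [DiscreteTopology A] :
    (Submodule.span ℂ (Set.range (evalCM (A := A)))).topologicalClosure = ⊤ := by
  let S : StarSubalgebra ℂ C(PontryaginDual A, ℂ) :=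
    { toSubalgebra := Algebra.adjoin ℂ (Set.range evalCM)
      star_mem' := by
        change Algebra.adjoin ℂ (Set.range (evalCM (A := A))) ≤
          star (Algebra.adjoin ℂ (Set.range (evalCM (A := A))))
        refine Algebra.adjoin_le ?_
        rintro - ⟨a, rfl⟩
        refine Algebra.subset_adjoin ⟨a⁻¹, ContinuousMap.ext fun χ => ?_⟩
        change ((χ a⁻¹ : Circle) : ℂ) = (starRingEnd ℂ) (χ a : ℂ)
        rw [map_inv, Circle.coe_inv_eq_conj] }
  have hS : S.SeparatesPoints := by
    intro χ ψ hne
    obtain ⟨a, ha⟩ : ∃ a, χ a ≠ ψ a := by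
      by_contra! h
      exact hne (PontryaginDual.ext h)
    exact ⟨_, ⟨evalCM a, Algebra.subset_adjoin ⟨a, rfl⟩, rfl⟩, fun h => ha (Circle.ext h)⟩
  have hspan : Subalgebra.toSubmodule (Algebra.adjoin ℂ (Set.range (evalCM (A := A)))) =
      Submodule.span ℂ (Set.range (evalCM (A := A))) := by
    refine Algebra.adjoin_eq_span_of_subset _ (Set.Subset.trans ?_ Submodule.subset_span)
    intro x hx
    refine Submonoid.closure_induction (fun _ => id) ⟨1, ?_⟩ ?_ hx
    · ext χ
      simp [evalCM]
    · rintro - - - - ⟨a, rfl⟩ ⟨b, rfl⟩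
      refine ⟨a * b, ContinuousMap.ext fun χ => ?_⟩
      simp [evalCM]
  rw [← hspan]
  exact congr_arg (Subalgebra.toSubmodule <| StarSubalgebra.toSubalgebra ·)
    (ContinuousMap.starSubalgebra_topologicalClosure_eq_top_of_separatesPoints S hS)

/-- Translating by a character `χ₀` with `χ₀ a ≠ 1` multiplies the integral by `χ₀ a`. -/
theorem integral_pontryaginDual_eval_eq_zero {A : Type*} [CommGroup A] [TopologicalSpace A]
    [DiscreteTopology A] [MeasurableSpace (PontryaginDual A)] [BorelSpace (PontryaginDual A)]
    (μ : Measure (PontryaginDual A)) [μ.IsMulLeftInvariant] {a : A} (ha : a ≠ 1) :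
    ∫ χ : PontryaginDual A, (χ a : ℂ) ∂μ = 0 := by
  obtain ⟨χ₀, h₀⟩ := exists_pontryaginDual_apply_ne_one ha
  have h := integral_mul_left_eq_self (μ := μ) (fun χ : PontryaginDual A => (χ a : ℂ)) χ₀
  have h' : ∫ χ : PontryaginDual A, ((χ₀ * χ) a : ℂ) ∂μ =
      (χ₀ a : ℂ) * ∫ χ : PontryaginDual A, (χ a : ℂ) ∂μ := by
    rw [← integral_const_mul]
    rfl
  rw [h'] at h
  by_contra hne
  exact h₀ (Circle.ext (mul_right_cancel₀ hne (h.trans (one_mul _).symm)))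

/-! ### The projection onto the free product of the quotients -/

section Projection

open Monoid

variable {ι : Type*} {G : ι → Type*} {H : Type*} [∀ i, CommGroup (G i)] [CommGroup H]

/-- The canonical map from the amalgamated product to the free product of the quotients. -/
def quotientProj (φ : ∀ i, H →* G i) : PushoutI φ →* FreeProdQuotients φ :=
  PushoutI.lift (fun i => CoprodI.of.comp (QuotientGroup.mk' (φ i).range)) 1 fun i => by
    refine MonoidHom.ext fun h => ?_
    have h1 : (QuotientGroup.mk' (φ i).range) (φ i h) = 1 :=
      (QuotientGroup.eq_one_iff _).2 ⟨h, rfl⟩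
    rw [MonoidHom.comp_apply, MonoidHom.comp_apply, h1, map_one, MonoidHom.one_apply]

theorem quotientProj_of (φ : ∀ i, H →* G i) (i : ι) (g : G i) :
    quotientProj φ (PushoutI.of i g) =
      CoprodI.of (i := i) (QuotientGroup.mk g : G i ⧸ (φ i).range) :=
  PushoutI.lift_of _ _ _ g

theorem quotientProj_base (φ : ∀ i, H →* G i) (h : H) :
    quotientProj φ (PushoutI.base φ h) = 1 :=
  PushoutI.lift_base _ _ _ h

theorem quotientProj_surjective (φ : ∀ i, H →* G i) :
    Function.Surjective (quotientProj φ) := by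
  intro k
  induction k using CoprodI.induction_on with
  | one => exact ⟨1, map_one _⟩
  | of i m =>
    obtain ⟨g, rfl⟩ := QuotientGroup.mk_surjective m
    exact ⟨PushoutI.of i g, quotientProj_of φ i g⟩
  | mul x y hx hy =>
    obtain ⟨a, rfl⟩ := hx
    obtain ⟨b, rfl⟩ := hy
    exact ⟨a * b, map_mul _ _ _⟩

/-- `H` lies in every Abelian factor `G i`, and the factors generate. -/
theorem pushoutI_base_commute (φ : ∀ i, H →* G i) (h : H) (x : PushoutI φ) :
    Commute x (PushoutI.base φ h) := by
  induction x using PushoutI.induction_on with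
  | of i g =>
    rw [← PushoutI.of_apply_eq_base φ i h]
    exact (Commute.all g (φ i h)).map _
  | base h' => exact (Commute.all h' h).map _
  | mul x y hx hy => exact hx.mul_left hy

theorem pushoutI_base_range_normal (φ : ∀ i, H →* G i) : (PushoutI.base φ).range.Normal where
  conj_mem := by
    rintro _ ⟨h, rfl⟩ x
    exact ⟨h, by rw [(pushoutI_base_commute φ h x).eq, mul_inv_cancel_right]⟩

/-- Normal forms are avoided: the maps from `G i / H` to the amalgam modulo `H` assemble to a map
`s` through which the quotient map factors, so whatever `quotientProj` kills lies in `H`. -/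
theorem exists_base_eq_of_quotientProj_eq_one (φ : ∀ i, H →* G i) {x : PushoutI φ}
    (hx : quotientProj φ x = 1) : ∃ h, PushoutI.base φ h = x := by
  have := pushoutI_base_range_normal φ
  let s : FreeProdQuotients φ →* PushoutI φ ⧸ (PushoutI.base φ).range :=
    CoprodI.lift fun i => QuotientGroup.map _ _ (PushoutI.of i) (by
      rintro _ ⟨h, rfl⟩
      exact ⟨h, (PushoutI.of_apply_eq_base φ i h).symm⟩)
  have hs : s.comp (quotientProj φ) = QuotientGroup.mk' _ := by
    refine PushoutI.hom_ext (fun i => MonoidHom.ext fun g => ?_) (MonoidHom.ext fun h => ?_)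
    · change s (quotientProj φ (PushoutI.of i g)) = _
      rw [quotientProj_of]
      simp [s]
    · change s (quotientProj φ (PushoutI.base φ h)) = _
      rw [quotientProj_base, map_one]
      exact ((QuotientGroup.eq_one_iff (N := (PushoutI.base φ).range) _).2 ⟨h, rfl⟩).symm
  have h1 : (QuotientGroup.mk' (PushoutI.base φ).range) x = 1 := by
    rw [← hs]
    change s (quotientProj φ x) = 1
    rw [hx, map_one]
  exact (QuotientGroup.eq_one_iff x).1 h1

end Projection

/-! ### Elementary tensors in the Hilbert space tensor product -/

section Tensor

variable {E F : Type*} [NormedAddCommGroup E] [InnerProductSpace ℂ E]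
  [NormedAddCommGroup F] [InnerProductSpace ℂ F]

/-- Elementary tensors, as a continuous bilinear map. -/
noncomputable def HilbertTensor.mkL (E F : Type*) [NormedAddCommGroup E] [InnerProductSpace ℂ E]
    [NormedAddCommGroup F] [InnerProductSpace ℂ F] : E →L[ℂ] F →L[ℂ] HilbertTensor E F :=
  (ContinuousLinearMap.compL ℂ F (E ⊗[ℂ] F) (UniformSpace.Completion (E ⊗[ℂ] F))
    UniformSpace.Completion.toComplL).comp (TensorProduct.mkL ℂ E F)

theorem HilbertTensor.inner_mkL (x x' : E) (y y' : F) :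
    inner ℂ (HilbertTensor.mkL E F x y) (HilbertTensor.mkL E F x' y') =
      inner ℂ x x' * inner ℂ y y' :=
  (UniformSpace.Completion.inner_coe (𝕜 := ℂ) (x ⊗ₜ[ℂ] y) (x' ⊗ₜ[ℂ] y')).trans
    (TensorProduct.inner_tmul ..)

theorem opTensor_mkL (S : E →L[ℂ] E) (T : F →L[ℂ] F) (x : E) (y : F) :
    opTensor S T (HilbertTensor.mkL E F x y) = HilbertTensor.mkL E F (S x) (T y) :=
  (TensorProduct.mapL S T).completion_apply_coe (x ⊗ₜ[ℂ] y)

theorem HilbertTensor.eq_top_of_mkL_mem (S : Submodule ℂ (HilbertTensor E F))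
    (hS : IsClosed (S : Set (HilbertTensor E F)))
    (h : ∀ x y, HilbertTensor.mkL E F x y ∈ S) : S = ⊤ := by
  refine Submodule.eq_top_iff'.2 fun z => ?_
  refine UniformSpace.Completion.induction_on (α := E ⊗[ℂ] F) z hS fun t => ?_
  induction t using TensorProduct.induction_on with
  | zero => exact S.zero_mem
  | tmul x y => exact h x y
  | add a b ha hb =>
    rw [UniformSpace.Completion.coe_add]
    exact S.add_mem ha hb

end Tensor

theorem Submodule.eq_top_of_span_dense {E : Type*} [NormedAddCommGroup E] [NormedSpace ℂ E]
    (S : Submodule ℂ E) (hS : IsClosed (S : Set E)) {s : Set E}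
    (hs : (Submodule.span ℂ s).topologicalClosure = ⊤) (h : ∀ x ∈ s, x ∈ S) : S = ⊤ :=
  top_le_iff.1 (hs ▸ Submodule.topologicalClosure_minimal _ (Submodule.span_le.2 h) hS)

/-! ### The standard basis of `ℓ²(Γ)` -/

section Regular

open Classical in
/-- The basis vector `δ_g` of `ℓ²(Γ)`. -/
noncomputable def deltaVec {Γ : Type*} (g : Γ) : EllTwo Γ := lp.single 2 g (1 : ℂ)

theorem deltaVec_apply_self {Γ : Type*} (g : Γ) : deltaVec g g = 1 := by
  classical
  exact lp.single_apply_self _ _ _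

theorem deltaVec_apply_ne {Γ : Type*} {g x : Γ} (h : x ≠ g) : deltaVec g x = 0 := by
  classical
  exact lp.single_apply_ne _ _ _ h

theorem leftRegular_deltaVec {Γ : Type*} [Group Γ] (g x : Γ) :
    leftRegular Γ g (deltaVec x) = deltaVec (g * x) := by
  refine lp.ext (funext fun y => ?_)
  change deltaVec x (g⁻¹ * y) = deltaVec (g * x) y
  by_cases h : y = g * x
  · subst h
    rw [inv_mul_cancel_left, deltaVec_apply_self, deltaVec_apply_self]
  · rw [deltaVec_apply_ne h, deltaVec_apply_ne fun h' => h (by rw [← h', mul_inv_cancel_left])]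

theorem inner_deltaVec {Γ : Type*} (g : Γ) (f : EllTwo Γ) :
    inner ℂ (deltaVec g) f = f g := by
  classical
  rw [deltaVec, lp.inner_single_left]
  simp

theorem span_deltaVec_closure_eq_top (Γ : Type*) :
    (Submodule.span ℂ (Set.range (deltaVec (Γ := Γ)))).topologicalClosure = ⊤ := by
  rw [← Submodule.orthogonal_orthogonal_eq_closure, Submodule.orthogonal_eq_top_iff,
    Submodule.eq_bot_iff]
  intro f hf
  refine lp.ext (funext fun g => ?_)
  rw [← inner_deltaVec]
  exact hf _ (Submodule.subset_span ⟨g, rfl⟩)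

end Regular

/-! ### Circle-valued functions in `L^p` and the twisted vectors -/

section CircleLp

variable {X : Type*} [MeasurableSpace X] (μ : Measure X) [IsFiniteMeasure μ]

/-- The class in `L^p` of a measurable circle-valued function. -/
noncomputable def circleLp (p : ℝ≥0∞) (c : measurableCircleFun X) : Lp ℂ p μ :=
  (MemLp.of_bound (p := p) (f := fun x => (c.1 x : ℂ)) (Measurable.aestronglyMeasurable c.2) 1
    (.of_forall fun x => (Circle.norm_coe (c.1 x)).le)).toLp _

theorem circleLp_ae (p : ℝ≥0∞) (c : measurableCircleFun X) :
    circleLp μ p c =ᵐ[μ] fun x => (c.1 x : ℂ) :=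
  MemLp.coeFn_toLp _

theorem mulOp_circleLp (c d : measurableCircleFun X) :
    mulOp μ (circleLp μ ∞ c) (circleLp μ 2 d) = circleLp μ 2 (c * d) := by
  refine Lp.ext ?_
  filter_upwards [mulOp_apply_ae μ (circleLp μ ∞ c) (circleLp μ 2 d), circleLp_ae μ ∞ c,
    circleLp_ae μ 2 d, circleLp_ae μ 2 (c * d)] with x h1 h2 h3 h4
  rw [h1, h2, h3, h4]
  exact (Circle.coe_mul (c.1 x) (d.1 x)).symm

theorem mulOp_circleLp_mulOp_inv (c : measurableCircleFun X) (f : Lp ℂ 2 μ) :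
    mulOp μ (circleLp μ ∞ c) (mulOp μ (circleLp μ ∞ c⁻¹) f) = f := by
  refine Lp.ext ?_
  filter_upwards [mulOp_apply_ae μ (circleLp μ ∞ c) (mulOp μ (circleLp μ ∞ c⁻¹) f),
    mulOp_apply_ae μ (circleLp μ ∞ c⁻¹) f, circleLp_ae μ ∞ c, circleLp_ae μ ∞ c⁻¹]
    with x h1 h2 h3 h4
  rw [h1, h2, h3, h4]
  change (c.1 x : ℂ) * ((((c.1 x)⁻¹ : Circle) : ℂ) * f x) = f x
  rw [← mul_assoc, ← Circle.coe_mul, mul_inv_cancel, Circle.coe_one, one_mul]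

theorem inner_circleLp (c d : measurableCircleFun X) :
    inner ℂ (circleLp μ 2 c) (circleLp μ 2 d) = ∫ x, (((c⁻¹ * d).1 x : Circle) : ℂ) ∂μ := by
  rw [L2.inner_def]
  refine integral_congr_ae ?_
  filter_upwards [circleLp_ae μ 2 c, circleLp_ae μ 2 d] with x h1 h2
  rw [h1, h2]
  change _ = (((c.1 x)⁻¹ * d.1 x : Circle) : ℂ)
  rw [Circle.coe_mul, Circle.coe_inv_eq_conj, RCLike.inner_apply, mul_comm]

variable {Γ K : Type*} [Group Γ] [Group K] (q : Γ →* K) (ε : Γ →* measurableCircleFun X)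

/-- The vector `δ_{q g} ⊗ ε g`, rescaled to have norm one. -/
noncomputable def twistedVec (g : Γ) : HilbertTensor (EllTwo K) (Lp ℂ 2 μ) :=
  (((Real.sqrt (μ.real Set.univ))⁻¹ : ℝ) : ℂ) •
    HilbertTensor.mkL _ _ (deltaVec (q g)) (circleLp μ 2 (ε g))

/-- The twisted vectors are permuted as `λ_g` permutes the `δ_x`, since `q` and `ε` are
homomorphisms. -/
theorem opTensor_twistedVec (g x : Γ) :
    opTensor (leftRegular K (q g)) (mulOp μ (circleLp μ ∞ (ε g))) (twistedVec μ q ε x) =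
      twistedVec μ q ε (g * x) := by
  rw [twistedVec, map_smul, opTensor_mkL, leftRegular_deltaVec, mulOp_circleLp, twistedVec,
    map_mul, map_mul]

end CircleLp

/-! ### Embedding the reduced C*-algebra of an extension -/

section Extension

variable {A Γ K : Type*} [CommGroup A] [TopologicalSpace A] [DiscreteTopology A]
  [Group Γ] [Group K] [MeasurableSpace (PontryaginDual A)] [BorelSpace (PontryaginDual A)]
  (μ : Measure (PontryaginDual A)) [IsFiniteMeasure μ]

/-- Evaluation at an element, as a measurable circle-valued function on the dual. -/
noncomputable def evalCircle : A →* measurableCircleFun (PontryaginDual A) where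
  toFun a := ⟨fun χ => χ a, (continuous_pontryaginDual_eval a).measurable⟩
  map_one' := Subtype.ext (funext fun χ => map_one χ)
  map_mul' a b := Subtype.ext (funext fun χ => map_mul χ a b)

theorem span_evalCircle_closure_eq_top [Countable A] :
    (Submodule.span ℂ (Set.range fun a : A => circleLp μ 2 (evalCircle a))).topologicalClosure =
      ⊤ := by
  -- Countability of `A` makes the dual pseudometrizable; this gives the regularity of `μ` under
  -- which continuous functions are dense in `L²`.
  let := TopologicalSpace.pseudoMetrizableSpacePseudoMetric (PontryaginDual A)
  have h := (ContinuousMap.toLp_denseRange ℂ μ ℂ (p := 2) (by simp)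
    ).topologicalClosure_map_submodule (span_evalCM_closure_eq_top A)
  have hr : (Set.range fun a : A => circleLp μ 2 (evalCircle a)) =
      (ContinuousMap.toLp 2 μ ℂ : C(PontryaginDual A, ℂ) →L[ℂ] Lp ℂ 2 μ) ''
        Set.range (evalCM (A := A)) := by
    rw [← Set.range_comp]
    refine congrArg Set.range (funext fun a => Lp.ext ?_)
    exact (circleLp_ae μ 2 _).trans (ContinuousMap.coeFn_toLp μ (evalCM a)).symm
  rw [hr]
  rw [Submodule.map_span] at h
  exact h

variable {q : Γ →* K} {ε : Γ →* measurableCircleFun (PontryaginDual A)} {b : A →* Γ}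

/-- Different images in `K` are separated by the first tensor factor. Within one fibre of `q`, two
elements differ by some `b a` with `a ≠ 1`, and the second factor contributes the vanishing integral
of evaluation at `a`. -/
theorem orthonormal_twistedVec [μ.IsMulLeftInvariant] [NeZero μ]
    (hb : ∀ g, q g = 1 → ∃ a, b a = g) (hε : ∀ a, ε (b a) = evalCircle a) :
    Orthonormal ℂ (twistedVec μ q ε) := by
  classical
  have hinner : ∀ g g', inner ℂ (twistedVec μ q ε g) (twistedVec μ q ε g') =
      ((μ.real Set.univ)⁻¹ : ℂ) *
        (inner ℂ (deltaVec (q g)) (deltaVec (q g')) *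
          ∫ χ, (((ε (g⁻¹ * g')).1 χ : Circle) : ℂ) ∂μ) := by
    intro g g'
    rw [twistedVec, twistedVec, inner_smul_left, inner_smul_right, HilbertTensor.inner_mkL,
      inner_circleLp, ← mul_assoc, map_mul, map_inv]
    congr 1
    rw [Complex.conj_ofReal, ← Complex.ofReal_mul, ← mul_inv,
      Real.mul_self_sqrt measureReal_nonneg, Complex.ofReal_inv]
  have hne : (μ.real Set.univ : ℂ) ≠ 0 := by
    simpa [Measure.real, ENNReal.toReal_eq_zero_iff] using NeZero.ne μ
  rw [orthonormal_iff_ite]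
  intro g g'
  rw [hinner, inner_deltaVec]
  split_ifs with h
  · subst h
    rw [deltaVec_apply_self, inv_mul_cancel, map_one]
    change _ * (1 * ∫ χ, ((1 : Circle) : ℂ) ∂μ) = 1
    rw [Circle.coe_one, integral_const, one_mul, Complex.real_smul, mul_one, inv_mul_cancel₀ hne]
  · by_cases hq : q g = q g'
    · obtain ⟨a, ha⟩ := hb (g⁻¹ * g') (by rw [map_mul, map_inv, hq, inv_mul_cancel])
      have ha1 : a ≠ 1 := by
        rintro rfl
        rw [map_one] at ha
        exact h (inv_mul_eq_one.1 ha.symm)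
      rw [← ha, hε]
      have h0 : ∫ χ, (((evalCircle a).1 χ : Circle) : ℂ) ∂μ = 0 :=
        integral_pontryaginDual_eval_eq_zero μ ha1
      rw [h0, mul_zero, mul_zero]
    · rw [deltaVec_apply_ne hq, zero_mul, mul_zero]

/-- The fibre of `q` through `g` contains all `g * b a`, giving `δ_{q g} ⊗ (ε g · evalCircle a)`.
Evaluations are total in `L²` and multiplication by `ε g` is invertible, so every `δ_{q g} ⊗ f` is
reached. -/
theorem span_twistedVec_closure_eq_top [Countable A] [NeZero μ] (hq : Function.Surjective q)
    (hqb : ∀ a, q (b a) = 1) (hε : ∀ a, ε (b a) = evalCircle a) :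
    (Submodule.span ℂ (Set.range (twistedVec μ q ε))).topologicalClosure = ⊤ := by
  set S := (Submodule.span ℂ (Set.range (twistedVec μ q ε))).topologicalClosure with hSdef
  have hS : IsClosed (S : Set (HilbertTensor (EllTwo K) (Lp ℂ 2 μ))) :=
    Submodule.isClosed_topologicalClosure _
  have hne : (((Real.sqrt (μ.real Set.univ))⁻¹ : ℝ) : ℂ) ≠ 0 := by
    have h0 : μ.real Set.univ ≠ 0 := by
      simpa [Measure.real, ENNReal.toReal_eq_zero_iff] using NeZero.ne μ
    exact Complex.ofReal_ne_zero.2 (inv_ne_zero ((Real.sqrt_ne_zero measureReal_nonneg).2 h0))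
  have hmem : ∀ g, HilbertTensor.mkL _ _ (deltaVec (q g)) (circleLp μ 2 (ε g)) ∈ S := fun g =>
    (Submodule.smul_mem_iff _ hne).1
      (Submodule.le_topologicalClosure _ (Submodule.subset_span ⟨g, rfl⟩))
  have hdelta : ∀ g f, HilbertTensor.mkL _ _ (deltaVec (q g)) f ∈ S := by
    intro g f
    let T : Lp ℂ 2 μ →L[ℂ] HilbertTensor (EllTwo K) (Lp ℂ 2 μ) :=
      (HilbertTensor.mkL _ _ (deltaVec (q g))).comp (mulOp μ (circleLp μ ∞ (ε g)))
    have hT : S.comap T.toLinearMap = ⊤ := by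
      refine Submodule.eq_top_of_span_dense _ (hS.preimage T.continuous)
        (span_evalCircle_closure_eq_top μ) ?_
      rintro _ ⟨a, rfl⟩
      change HilbertTensor.mkL _ _ (deltaVec (q g))
        (mulOp μ (circleLp μ ∞ (ε g)) (circleLp μ 2 (evalCircle a))) ∈ S
      have h := hmem (g * b a)
      rwa [map_mul, hqb, mul_one, map_mul, hε, ← mulOp_circleLp] at h
    have h : mulOp μ (circleLp μ ∞ (ε g)⁻¹) f ∈ S.comap T.toLinearMap := hT ▸ Submodule.mem_top
    have h' : HilbertTensor.mkL _ _ (deltaVec (q g))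
      (mulOp μ (circleLp μ ∞ (ε g)) (mulOp μ (circleLp μ ∞ (ε g)⁻¹) f)) ∈ S := h
    rwa [mulOp_circleLp_mulOp_inv] at h'
  refine HilbertTensor.eq_top_of_mkL_mem S hS fun x f => ?_
  let T : EllTwo K →L[ℂ] HilbertTensor (EllTwo K) (Lp ℂ 2 μ) := (HilbertTensor.mkL _ _).flip f
  have hT : S.comap T.toLinearMap = ⊤ := by
    refine Submodule.eq_top_of_span_dense _ (hS.preimage T.continuous)
      (span_deltaVec_closure_eq_top K) ?_
    rintro _ ⟨k, rfl⟩
    obtain ⟨g, rfl⟩ := hq k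
    exact hdelta g f
  exact (hT ▸ Submodule.mem_top : x ∈ S.comap T.toLinearMap)

/-- Let `Γ` be an extension of `K` by an Abelian group `A`, together with a measurable family `ε` of
characters of `Γ` extending the characters of `A`. Then `λ_g ↦ λ_{q g} ⊗ ε g` extends to an
embedding of reduced group C*-algebras. -/
theorem exists_reducedCStar_embedding [Countable A] [μ.IsMulLeftInvariant] [NeZero μ]
    (hq : Function.Surjective q) (hqb : ∀ a, q (b a) = 1) (hb : ∀ g, q g = 1 → ∃ a, b a = g)
    (hε : ∀ a, ε (b a) = evalCircle a) :
    ∃ ψ : reducedCStar Γ →⋆ₐ[ℂ] spatialTensor (reducedCStar K) (LInfty μ),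
      Function.Injective ψ ∧ ∀ g, (ψ (groupUnitary g) :
        HilbertTensor (EllTwo K) (Lp ℂ 2 μ) →L[ℂ] HilbertTensor (EllTwo K) (Lp ℂ 2 μ)) =
          opTensor (leftRegular K (q g)) (mulOp μ (circleLp μ ∞ (ε g))) := by
  classical
  have hspan := span_twistedVec_closure_eq_top μ hq hqb hε
  let B : HilbertBasis Γ ℂ (HilbertTensor (EllTwo K) (Lp ℂ 2 μ)) :=
    HilbertBasis.mk (orthonormal_twistedVec μ hb hε) hspan.ge
  have hB : ∀ g, B g = twistedVec μ q ε g := fun g => congrFun (HilbertBasis.coe_mk _ _) g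
  have hdelta : ∀ g, B.repr.symm (deltaVec g) = twistedVec μ q ε g := fun g => by
    rw [← hB, ← B.repr_symm_single g]
    congr!
  -- Conjugation by the unitary taking `δ_g` to `twistedVec μ q ε g`; it is injective on all bounded
  -- operators, hence on the reduced algebra.
  let Φ : (EllTwo Γ →L[ℂ] EllTwo Γ) →⋆ₐ[ℂ]
      (HilbertTensor (EllTwo K) (Lp ℂ 2 μ) →L[ℂ] HilbertTensor (EllTwo K) (Lp ℂ 2 μ)) :=
    B.repr.symm.conjStarAlgEquiv
  have hΦ : ∀ g, Φ (leftRegular Γ g) =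
      opTensor (leftRegular K (q g)) (mulOp μ (circleLp μ ∞ (ε g))) := by
    intro g
    refine ContinuousLinearMap.ext_on (s := Set.range (twistedVec μ q ε)) ?_ ?_
    · exact (Submodule.dense_iff_topologicalClosure_eq_top).2 hspan
    · rintro _ ⟨x, rfl⟩
      rw [opTensor_twistedVec, ← hdelta, ← hdelta]
      change B.repr.symm (leftRegular Γ g (B.repr.symm.symm (B.repr.symm (deltaVec x)))) = _
      rw [LinearIsometryEquiv.symm_apply_apply, leftRegular_deltaVec]
  have hcont : Continuous Φ := by
    change Continuous fun x => B.repr.symm.conjStarAlgEquiv x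
    simp_rw [LinearIsometryEquiv.conjStarAlgEquiv_apply]
    fun_prop
  -- The preimage of the spatial tensor product is a closed star subalgebra, so it suffices to check
  -- the generators `λ_g`.
  have hle : reducedCStar Γ ≤
      (spatialTensor (reducedCStar K) (LInfty μ)).comap Φ := by
    refine StarSubalgebra.topologicalClosure_minimal (StarAlgebra.adjoin_le ?_) ?_
    · rintro _ ⟨g, rfl⟩
      refine StarSubalgebra.le_topologicalClosure _ (StarAlgebra.subset_adjoin ℂ _
        ⟨_, leftRegular_mem K (q g), _, ⟨circleLp μ ∞ (ε g), rfl⟩, hΦ g⟩)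
    · exact (StarSubalgebra.isClosed_topologicalClosure _).preimage hcont
  refine ⟨StarAlgHom.codRestrict (Φ.comp (reducedCStar Γ).subtype) _
    fun x => hle x.2, fun x y hxy => ?_, hΦ⟩
  exact Subtype.ext (B.repr.symm.conjStarAlgEquiv.injective (congrArg Subtype.val hxy))

end Extension

/-! ### The amalgamated free product -/

theorem mainTheorem2 {ι : Type*} [Countable ι]
    {G : ι → Type*} [∀ i, CommGroup (G i)] [∀ i, Countable (G i)]
    [∀ i, TopologicalSpace (G i)] [∀ i, DiscreteTopology (G i)]
    {H : Type*} [CommGroup H] [Countable H] [TopologicalSpace H] [DiscreteTopology H]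
    (φ : ∀ i, H →* G i) (hφ : ∀ i, Function.Injective (φ i))
    [MeasurableSpace (PontryaginDual H)] [BorelSpace (PontryaginDual H)]
    [∀ i, MeasurableSpace (PontryaginDual (G i))] [∀ i, BorelSpace (PontryaginDual (G i))]
    (μ : Measure (PontryaginDual H)) [μ.IsHaarMeasure] :
    ∃ (ψ : reducedCStar (Monoid.PushoutI φ) →⋆ₐ[ℂ]
          spatialTensor (reducedCStar (FreeProdQuotients φ)) (LInfty μ))
      (e : ∀ i, PontryaginDual H → PontryaginDual (G i)),
      Function.Injective ψ ∧
      (∀ i, Measurable (e i)) ∧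
      (∀ i (χ : PontryaginDual H) (h : H), e i χ (φ i h) = χ h) ∧
      (∀ i (g : G i), ∃ f : Lp ℂ ∞ μ,
        (f =ᵐ[μ] fun χ => (e i χ g : ℂ)) ∧
        (ψ (groupUnitary (Monoid.PushoutI.of i g)) :
            HilbertTensor (EllTwo (FreeProdQuotients φ)) (Lp ℂ 2 μ) →L[ℂ]
              HilbertTensor (EllTwo (FreeProdQuotients φ)) (Lp ℂ 2 μ)) =
          opTensor
            (leftRegular (FreeProdQuotients φ)
              (Monoid.CoprodI.of (i := i) (QuotientGroup.mk g : G i ⧸ (φ i).range)))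
            (mulOp μ f)) := by
  choose E hE using fun i => exists_measurableCircleFun_extension (φ i) (hφ i)
    (evalCircle (A := H))
  -- The `E i` glue because all of them restrict to the same `evalCircle` on `H`.
  let ε : Monoid.PushoutI φ →* measurableCircleFun (PontryaginDual H) :=
    Monoid.PushoutI.lift E evalCircle fun i => MonoidHom.ext (hE i)
  obtain ⟨ψ, hψ, hψg⟩ := exists_reducedCStar_embedding μ (ε := ε) (b := Monoid.PushoutI.base φ)
    (quotientProj_surjective φ) (quotientProj_base φ)
    (fun _ => exists_base_eq_of_quotientProj_eq_one φ) (Monoid.PushoutI.lift_base _ _ _)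
  -- `E i` is multiplicative as a map into functions, so fixing `χ` gives a character with no
  -- exceptional null set.
  let e (i : ι) (χ : PontryaginDual H) : G i →ₜ* Circle :=
    { toFun := fun g => (E i g).1 χ
      map_one' := by rw [map_one]; rfl
      map_mul' := fun g g' => by rw [map_mul]; rfl
      continuous_toFun := continuous_of_discreteTopology }
  refine ⟨ψ, e, hψ, fun i => measurable_pontryaginDual fun g => (E i g).2, fun i χ h => ?_,
    fun i g => ⟨circleLp μ ∞ (E i g), circleLp_ae μ ∞ _, ?_⟩⟩
  · change (E i (φ i h)).1 χ = χ h
    rw [hE]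
    rfl
  · rw [hψg, quotientProj_of]
    exact congrArg (fun c => opTensor _ (mulOp μ (circleLp μ ∞ c)))
      (Monoid.PushoutI.lift_of E evalCircle _ g)
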